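/- Consider a network caching problem with $n\ge 1$ users, $m\ge 1$ caches, each of capacity $C\ge 1$ files, and a library of $N$ files. Users and caches are joined by a biregular bipartite graph: every user $i$ is connected to exactly $d_L$ caches $\partial^+(i)$ and every cache to exactly $d\ge 1$ users, so $nd_L=md$. In each slot $t=1,\dots,T$ an online policy $\pi$, which may be randomized, chooses a configuration $y_t=(y_t^j)_{j\le m}$, where $y_t^j\in\{0,1\}^N$ is the indicator vector of the at most $C$ files stored in cache $j$, as a function of the earlier requests $x_1,\dots,x_{t-1}$ and of its internal randomness. Then every user $i$ requests one file, encoded as a unit vector $x_t^i\in\{0,1\}^N$, and the reward is $$q(x_t,y_t)=\sum_{i=1}^n x_t^i\cdot\min\Big\{\mathbf 1,\ \sum_{j\in\partial^+(i)}y_t^j\Big\}.$$ The regret of $\pi$ on a fixed request sequence $x=(x_1,\dots,x_T)$ is $$R_T^\pi(x)=\max_{y}\sum_{t=1}^T q(x_t,y)-\mathbb E\sum_{t=1}^T q(x_t,y_t),$$ where the maximum is over all feasible static configurations and the expectation is over the internal randomness of $\pi$. Theorem. There is a constant $K>0$ depending only on $n,m,d,C$ such that for every biregular network as above, every library size $N\ge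 2C\min\{m,\,d_Ld\}=\min\{2mC,\ 2mCd^2/n\}$, every horizon $T\ge 1$ and every online caching policy $\pi$ (which may depend on $T$ and on the network), there is a request sequence $x$ with $$R_T^\pi(x)\ \ge\ \max\left(\sqrt{\frac{mnCT}{2\pi}},\ d\sqrt{\frac{mCT}{2\pi}}\right)-\frac{K}{\sqrt T}.$$ (Inside the square roots $\pi$ is the circle constant.) -/

import Mathlib

/-! Network caching: `n` users, `m` caches of capacity `C`, a library of `N` files, and a bipartite
network between users and caches, given by its set of edges. -/

/-- The caches connected to user `i`. -/
def cachesOf {n m : ℕ} (E : Finset (Fin n × Fin m)) (i : Fin n) : Finset (Fin m) :=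
  Finset.univ.filter (fun j => (i, j) ∈ E)

/-- The users connected to cache `j`. -/
def usersOf {n m : ℕ} (E : Finset (Fin n × Fin m)) (j : Fin m) : Finset (Fin n) :=
  Finset.univ.filter (fun i => (i, j) ∈ E)

/-- A cache configuration: every cache holds a set of at most `C` of the `N` files. -/
abbrev CacheConfig (m N C : ℕ) : Type :=
  {y : Fin m → Finset (Fin N) // ∀ j, (y j).card ≤ C}

/-- The requests of one slot: every user requests one file. -/
abbrev Requests (n N : ℕ) : Type := Fin n → Fin N

/-- The reward of one slot, `∑ᵢ xⁱ · min (1, ∑_{j connected to i} yʲ)`, where `xⁱ` is the unit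
vector of the file requested by user `i` and `yʲ` is the 0/1 indicator vector of the files held by
cache `j`: the number of users whose file is held by one of their caches. -/
noncomputable def reward {n m N C : ℕ} (E : Finset (Fin n × Fin m))
    (x : Requests n N) (y : CacheConfig m N C) : ℝ :=
  ∑ i : Fin n, min 1 (∑ j ∈ cachesOf E i, if x i ∈ y.1 j then (1 : ℝ) else 0)

/-- A (possibly randomized) online caching policy with internal randomness `ω : Ω`: the
configuration used in slot `t` (slots are numbered from `0`) is a function of the requests of the
slots before `t` and of `ω`. -/
structure OnlinePolicy (Ω : Type*) [MeasurableSpace Ω] (n m N C : ℕ) where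
  config : (t : ℕ) → (Fin t → Requests n N) → Ω → CacheConfig m N C
  measurable_config : ∀ (t : ℕ) (h : Fin t → Requests n N) (y : CacheConfig m N C),
    MeasurableSet {ω | config t h ω = y}

/-- The requests of the slots before slot `t`. -/
def history {n N T : ℕ} (x : Fin T → Requests n N) (t : Fin T) : Fin (t : ℕ) → Requests n N :=
  fun s => x (Fin.castLE t.2.le s)

/-- The total reward of the best static configuration in hindsight. The supremum is over a finite
nonempty type, hence a maximum. -/
noncomputable def bestStaticReward {n m N T : ℕ} (C : ℕ) (E : Finset (Fin n × Fin m))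
    (x : Fin T → Requests n N) : ℝ :=
  ⨆ y : CacheConfig m N C, ∑ t : Fin T, reward E (x t) y

/-- The (expected) total reward of a policy on the request sequence `x`. -/
noncomputable def policyReward {Ω : Type*} [MeasurableSpace Ω] {n m N C T : ℕ}
    (E : Finset (Fin n × Fin m)) (P : MeasureTheory.Measure Ω) (p : OnlinePolicy Ω n m N C)
    (x : Fin T → Requests n N) : ℝ :=
  ∫ ω, ∑ t : Fin T, reward E (x t) (p.config t (history x t) ω) ∂P

/-- The (expected) regret of a policy on the request sequence `x`. -/
noncomputable def regretOn {Ω : Type*} [MeasurableSpace Ω] {n m N C T : ℕ}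
    (E : Finset (Fin n × Fin m)) (P : MeasureTheory.Measure Ω) (p : OnlinePolicy Ω n m N C)
    (x : Fin T → Requests n N) : ℝ :=
  bestStaticReward C E x - policyReward E P p x

/-! Probabilistic method. Let all users request the same file, drawn afresh in each slot and
uniformly from `2kC` files, where `k = min m (dL * d)`. The files are grouped into `kC` pairs, `C`
pairs for each of `k` colours. Past requests say nothing about the next one, so every policy
collects on average at most `T · n·dL·C / (2kC)` (`expect_policyReward_le`). In hindsight, colour
the caches so that those of one user have distinct colours (`exists_cache_coloring`) and store in
each cache the more requested file of every pair of its colour (`sum_le_bestStaticReward`). A pair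
requested `b` times, with imbalance `S` between its files, gives `(b + |S|)/2`. The `b/2` parts
average to the bound on the policy, so the mean regret is at least `(mdC/2) · E|S|`. Here `S` is a
simple random walk run for a random number of steps of mean `μ = T/(kC)`, and `E|S| ≥ √(2/π) (√μ -
1/√μ)` (`le_expect_abs_sum_ite_boolSign`). The bounds `k ≤ m` and `k ≤ dL * d` give the two terms of
the maximum. -/

/-! ### Mean distance of the simple random walk. -/

/-- The mean of `h` at the position of a simple random walk on `ℤ` started at `x`, after `k`
steps. -/
noncomputable def walkMean (h : ℤ → ℝ) : ℕ → ℤ → ℝ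
  | 0, x => h x
  | k + 1, x => (walkMean h k (x + 1) + walkMean h k (x - 1)) / 2

theorem walkMean_nonneg {h : ℤ → ℝ} (hh : ∀ x, 0 ≤ h x) (k : ℕ) (x : ℤ) :
    0 ≤ walkMean h k x := by
  induction k generalizing x with
  | zero => exact hh x
  | succ k ih => exact div_nonneg (add_nonneg (ih _) (ih _)) zero_le_two

/-- Discrete Tanaka formula: a step leaves the mean of `|z|` unchanged away from `0` and raises it
by `1` at `0`. -/
theorem walkMean_abs_succ (k : ℕ) (x : ℤ) :
    walkMean (fun z => |(z : ℝ)|) (k + 1) x =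
      walkMean (fun z => |(z : ℝ)|) k x + walkMean (fun z => if z = 0 then 1 else 0) k x := by
  induction k generalizing x with
  | zero =>
    simp only [walkMean]
    rcases lt_trichotomy x 0 with hx | rfl | hx
    · have h1 : (x : ℝ) ≤ -1 := by exact_mod_cast Int.le_sub_one_of_lt hx
      push_cast
      rw [if_neg hx.ne, abs_of_nonpos (by linarith), abs_of_nonpos (by linarith),
        abs_of_nonpos (by linarith)]
      ring
    · norm_num
    · have h1 : (1 : ℝ) ≤ x := by exact_mod_cast hx
      push_cast
      rw [if_neg hx.ne', abs_of_nonneg (by linarith), abs_of_nonneg (by linarith),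
        abs_of_nonneg (by linarith)]
      ring
  | succ k ih =>
    rw [walkMean, ih, ih, walkMean, walkMean]
    ring

theorem walkMean_ite_eq_zero (k : ℕ) (x : ℤ) (hx : (k : ℤ) < x) :
    walkMean (fun z => if z = 0 then 1 else 0) k x = 0 := by
  induction k generalizing x with
  | zero => simp only [walkMean]; rw [if_neg]; push_cast at hx; omega
  | succ k ih =>
    push_cast at hx
    rw [walkMean, ih _ (by omega), ih _ (by omega)]
    simp

/-- Reaching `0` from `k - 2j` in `k` steps takes exactly `j` up-steps. With a general starting
point, the induction step is Pascal's rule. -/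
theorem walkMean_ite_eq_choose (k j : ℕ) :
    walkMean (fun z => if z = 0 then 1 else 0) k ((k : ℤ) - 2 * j) = (k.choose j : ℝ) / 2 ^ k := by
  induction k generalizing j with
  | zero =>
    cases j with
    | zero => simp [walkMean]
    | succ j =>
      simp only [walkMean, Nat.choose_zero_succ]
      rw [if_neg (by push_cast; omega)]
      simp
  | succ k ih =>
    rw [walkMean]
    cases j with
    | zero =>
      rw [walkMean_ite_eq_zero _ _ (by push_cast; omega)]
      have := ih 0
      rw [show ((k + 1 : ℕ) : ℤ) - 2 * (0 : ℕ) - 1 = (k : ℤ) - 2 * (0 : ℕ) by push_cast; ring, this]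
      simp [pow_succ]
      ring
    | succ j =>
      rw [show ((k + 1 : ℕ) : ℤ) - 2 * (j + 1 : ℕ) + 1 = (k : ℤ) - 2 * j by push_cast; ring,
        show ((k + 1 : ℕ) : ℤ) - 2 * (j + 1 : ℕ) - 1 = (k : ℤ) - 2 * (j + 1 : ℕ) by
          push_cast; ring, ih, ih, Nat.choose_succ_succ, pow_succ]
      push_cast
      ring

/-- The probability that a simple random walk on `ℤ` is at its starting point after `2 * k`
steps. -/
noncomputable def returnProb (k : ℕ) : ℝ := (k.centralBinom : ℝ) / 4 ^ k

theorem returnProb_nonneg (k : ℕ) : 0 ≤ returnProb k := by unfold returnProb; positivity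

theorem walkMean_ite_two_mul (k : ℕ) :
    walkMean (fun z => if z = 0 then 1 else 0) (2 * k) 0 = returnProb k := by
  have := walkMean_ite_eq_choose (2 * k) k
  rw [show ((2 * k : ℕ) : ℤ) - 2 * k = 0 by push_cast; ring] at this
  rw [this, returnProb, Nat.centralBinom, pow_mul]
  norm_num

theorem succ_mul_returnProb_succ (k : ℕ) :
    (2 * k + 2) * returnProb (k + 1) = (2 * k + 1) * returnProb k := by
  have h : ((k : ℝ) + 1) * (k + 1).centralBinom = 2 * (2 * k + 1) * k.centralBinom := by
    exact_mod_cast Nat.succ_mul_centralBinom_succ k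
  simp only [returnProb, pow_succ]
  field_simp
  linarith

/-- This link to the partial Wallis products turns `W k ≤ π / 2` into a lower bound on `returnProb`
with the sharp constant. -/
theorem returnProb_sq_mul_wallis (k : ℕ) :
    returnProb k ^ 2 * (2 * k + 1) * Real.Wallis.W k = 1 := by
  induction k with
  | zero => simp [returnProb, Real.Wallis.W]
  | succ k ih =>
    have h : returnProb (k + 1) = (2 * k + 1) * returnProb k / (2 * k + 2) := by
      rw [← succ_mul_returnProb_succ]; field_simp
    rw [Real.Wallis.W_succ, h]
    conv_rhs => rw [← ih]
    push_cast
    field_simp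
    ring

theorem le_returnProb (k : ℕ) :
    Real.sqrt (2 / Real.pi) / Real.sqrt (2 * k + 1) ≤ returnProb k := by
  rw [← Real.sqrt_div (by positivity)]
  refine Real.sqrt_le_iff.2 ⟨returnProb_nonneg k, ?_⟩
  have h1 := returnProb_sq_mul_wallis k
  have h2 := Real.Wallis.W_le k
  have h3 := Real.pi_pos
  rw [div_div, div_le_iff₀ (by positivity)]
  have : returnProb k ^ 2 * (2 * k + 1) * Real.Wallis.W k
      ≤ returnProb k ^ 2 * (2 * k + 1) * (Real.pi / 2) := by gcongr
  nlinarith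

/-- Two Tanaka steps add at least `returnProb k`, which is exactly the growth of the left side by
`succ_mul_returnProb_succ`. -/
theorem two_mul_returnProb_le (k : ℕ) :
    2 * k * returnProb k ≤ walkMean (fun z => |(z : ℝ)|) (2 * k) 0 := by
  induction k with
  | zero => simp [walkMean]
  | succ k ih =>
    have h1 := walkMean_abs_succ (2 * k) 0
    have h2 := walkMean_abs_succ (2 * k + 1) 0
    have h3 : 0 ≤ walkMean (fun z => if z = 0 then 1 else 0) (2 * k + 1) 0 :=
      walkMean_nonneg (fun z => by positivity) _ _
    have h4 := succ_mul_returnProb_succ k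
    rw [walkMean_ite_two_mul] at h1
    rw [show 2 * (k + 1) = 2 * k + 1 + 1 by ring]
    push_cast
    linarith

/-- The mean distance covered by `b` steps of a simple random walk. -/
theorem le_walkMean_abs (b : ℕ) :
    Real.sqrt (2 / Real.pi) * (b / Real.sqrt (b + 1)) ≤ walkMean (fun z => |(z : ℝ)|) b 0 := by
  obtain ⟨k, rfl | rfl⟩ := b.even_or_odd'
  · refine le_trans ?_ (two_mul_returnProb_le k)
    have := mul_le_mul_of_nonneg_left (le_returnProb k) (by positivity : (0 : ℝ) ≤ 2 * k)
    push_cast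
    calc _ = _ := by ring
      _ ≤ _ := this
  · rw [walkMean_abs_succ, walkMean_ite_two_mul]
    have h1 := two_mul_returnProb_le k
    have h2 := mul_le_mul_of_nonneg_left (le_returnProb k) (by positivity : (0 : ℝ) ≤ 2 * k + 1)
    have h3 : Real.sqrt (2 / Real.pi) * (((2 * k + 1 : ℕ) : ℝ) / Real.sqrt ((2 * k + 1 : ℕ) + 1))
        ≤ (2 * k + 1) * (Real.sqrt (2 / Real.pi) / Real.sqrt (2 * k + 1)) := by
      push_cast
      rw [← mul_div_assoc, ← mul_div_assoc, mul_comm]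
      gcongr
      linarith
    linarith

/-! ### Independent uniform draws and the lazy random walk. -/

/-- The tangent of `1 / √u` at `u = ν` lies below the graph. -/
theorem one_div_sqrt_ge_tangent {u ν : ℝ} (hu : 0 < u) (hν : 0 < ν) :
    1 / Real.sqrt ν * (1 - (u - ν) / (2 * ν)) ≤ 1 / Real.sqrt u := by
  obtain ⟨a, ha, rfl⟩ : ∃ a, 0 < a ∧ a ^ 2 = u := ⟨_, Real.sqrt_pos.2 hu, Real.sq_sqrt hu.le⟩
  obtain ⟨c, hc, rfl⟩ : ∃ c, 0 < c ∧ c ^ 2 = ν := ⟨_, Real.sqrt_pos.2 hν, Real.sq_sqrt hν.le⟩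
  rw [Real.sqrt_sq ha.le, Real.sqrt_sq hc.le, ← sub_nonneg]
  have : 1 / a - 1 / c * (1 - (a ^ 2 - c ^ 2) / (2 * c ^ 2))
      = (a - c) ^ 2 * (a + 2 * c) / (2 * a * c ^ 3) := by
    field_simp
    ring
  rw [this]
  positivity

-- Resampling one coordinate preserves the average; this plays the role of independence throughout.
open scoped BigOperators in
theorem expect_eq_expect_update {ι A : Type*} [Fintype ι] [DecidableEq ι] [Fintype A] [Nonempty A]
    (t : ι) (G : (ι → A) → ℝ) :
    𝔼 f, G f = 𝔼 f, 𝔼 a, G (Function.update f t a) := by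
  have h : ∀ G : (ι → A) → ℝ, 𝔼 f, G f = 𝔼 a, 𝔼 r, G ((Equiv.funSplitAt t A).symm (a, r)) := by
    intro G
    rw [← Finset.expect_product', Finset.univ_product_univ]
    exact Fintype.expect_equiv (Equiv.funSplitAt t A) _ _
      (fun f => congrArg G ((Equiv.funSplitAt t A).symm_apply_apply f).symm)
  rw [h, Finset.expect_comm (f := fun f a => G (Function.update f t a))]
  refine Finset.expect_congr rfl fun a _ => ?_
  rw [h (fun f => G (Function.update f t a))]
  rw [← Fintype.expect_const (ι := A) (𝔼 r, G ((Equiv.funSplitAt t A).symm (a, r)))]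
  refine Finset.expect_congr rfl fun b _ => Finset.expect_congr rfl fun r _ => ?_
  congr 1
  ext s
  by_cases hs : s = t
  · subst hs; simp [Equiv.funSplitAt, Equiv.piSplitAt]
  · simp [Equiv.funSplitAt, Equiv.piSplitAt, hs]

open scoped BigOperators in
theorem expect_apply_coord {ι A : Type*} [Fintype ι] [DecidableEq ι] [Fintype A] [Nonempty A]
    (t : ι) (φ : A → ℝ) : 𝔼 f : ι → A, φ (f t) = 𝔼 a, φ a := by
  rw [expect_eq_expect_update t]
  simp

open scoped BigOperators in
theorem expect_mul_apply_coord {ι A : Type*} [Fintype ι] [DecidableEq ι] [Fintype A] [Nonempty A]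
    {s t : ι} (hst : s ≠ t) (φ ψ : A → ℝ) :
    𝔼 f : ι → A, φ (f s) * ψ (f t) = (𝔼 a, φ a) * 𝔼 a, ψ a := by
  rw [expect_eq_expect_update t]
  simp only [Function.update_self, Function.update_of_ne hst]
  simp_rw [← Finset.mul_expect, ← Finset.expect_mul]
  rw [expect_apply_coord]

/-- The sign `±1` coded by a truth value. -/
def boolSign (b : Bool) : ℤ := if b then 1 else -1

open scoped BigOperators in
theorem expect_sum_boolSign {ι : Type*} [Fintype ι] [DecidableEq ι] (h : ℤ → ℝ) (s : Finset ι)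
    (x : ℤ) : 𝔼 ε : ι → Bool, h (x + ∑ t ∈ s, boolSign (ε t)) = walkMean h s.card x := by
  induction s using Finset.induction_on generalizing x with
  | empty => simp [walkMean]
  | insert t s ht ih =>
    rw [Finset.card_insert_of_notMem ht, walkMean, ← ih, ← ih, expect_eq_expect_update t,
      ← Finset.expect_add_distrib, Finset.expect_div]
    refine Finset.expect_congr rfl fun ε _ => ?_
    have h1 : ∀ b, x + ∑ r ∈ insert t s, boolSign (Function.update ε t b r)
        = x + boolSign b + ∑ r ∈ s, boolSign (ε r) := by
      intro b
      rw [Finset.sum_insert ht, Function.update_self, add_assoc]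
      congr 2
      refine Finset.sum_congr rfl fun r hr => ?_
      rw [Function.update_of_ne]
      rintro rfl
      exact ht hr
    simp_rw [h1]
    rw [Fintype.expect_eq_sum_div_card]
    simp [boolSign, sub_eq_add_neg]

open scoped BigOperators in
theorem expect_card_filter {T : ℕ} {Q : Type*} [Fintype Q] [DecidableEq Q] [Nonempty Q] (q : Q) :
    𝔼 g : Fin T → Q, ((Finset.univ.filter (fun t => g t = q)).card : ℝ) = T / Fintype.card Q := by
  simp_rw [Finset.card_filter]
  push_cast
  rw [Finset.expect_sum_comm]
  simp_rw [expect_apply_coord _ (fun a => if a = q then (1 : ℝ) else 0)]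
  rw [Fintype.expect_eq_sum_div_card]
  simp [div_eq_mul_inv]

open scoped BigOperators in
theorem expect_card_filter_sq_le {T : ℕ} {Q : Type*} [Fintype Q] [DecidableEq Q] [Nonempty Q]
    (q : Q) :
    𝔼 g : Fin T → Q, ((Finset.univ.filter (fun t => g t = q)).card : ℝ) ^ 2
      ≤ T / Fintype.card Q + (T / Fintype.card Q) ^ 2 := by
  have hE : 𝔼 a : Q, (if a = q then (1 : ℝ) else 0) = 1 / Fintype.card Q := by
    rw [Fintype.expect_eq_sum_div_card]
    simp
  simp_rw [Finset.card_filter]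
  push_cast
  simp_rw [sq, Finset.sum_mul_sum]
  rw [Finset.expect_sum_comm]
  simp_rw [Finset.expect_sum_comm]
  calc _ ≤ ∑ s : Fin T, ∑ t : Fin T, ((if s = t then (1 / Fintype.card Q : ℝ) else 0)
        + 1 / Fintype.card Q * (1 / Fintype.card Q)) := by
        refine Finset.sum_le_sum fun s _ => Finset.sum_le_sum fun t _ => ?_
        by_cases hst : s = t
        · subst hst
          have hsq : ∀ a : Q, (if a = q then (1 : ℝ) else 0) * (if a = q then 1 else 0)
              = if a = q then 1 else 0 := fun a => by split_ifs <;> simp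
          simp_rw [hsq]
          rw [expect_apply_coord _ (fun a => if a = q then (1 : ℝ) else 0), hE, if_pos trivial]
          have : (0 : ℝ) ≤ 1 / Fintype.card Q * (1 / Fintype.card Q) := by positivity
          linarith
        · rw [expect_mul_apply_coord hst (fun a => if a = q then (1 : ℝ) else 0)
            (fun a => if a = q then (1 : ℝ) else 0), hE, if_neg hst, zero_add]
    _ = _ := by
        simp only [Finset.sum_add_distrib, Finset.sum_ite_eq, Finset.mem_univ, if_true,
          Finset.sum_const, Finset.card_univ, Fintype.card_fin, nsmul_eq_mul]
        ring

open scoped BigOperators in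
/-- The mean absolute value of a lazy random walk after `T` steps. -/
theorem le_expect_abs_sum_ite_boolSign {T : ℕ} (hT : 0 < T) {Q : Type*} [Fintype Q]
    [DecidableEq Q] [Nonempty Q] (q : Q) :
    Real.sqrt (2 / Real.pi) * (Real.sqrt (T / Fintype.card Q)
        - 1 / Real.sqrt (T / Fintype.card Q))
      ≤ 𝔼 f : Fin T → Q × Bool,
          |((∑ t, if (f t).1 = q then boolSign (f t).2 else 0 : ℤ) : ℝ)| := by
  have hsplit : 𝔼 f : Fin T → Q × Bool,
      |((∑ t, if (f t).1 = q then boolSign (f t).2 else 0 : ℤ) : ℝ)|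
      = 𝔼 g : Fin T → Q, walkMean (fun z => |(z : ℝ)|)
          (Finset.univ.filter (fun t => g t = q)).card 0 := by
    rw [Fintype.expect_equiv (Equiv.arrowProdEquivProdArrow (Fin T) (fun _ => Q) (fun _ => Bool))
      (fun f => |((∑ t, if (f t).1 = q then boolSign (f t).2 else 0 : ℤ) : ℝ)|)
      (fun p => |((∑ t, if p.1 t = q then boolSign (p.2 t) else 0 : ℤ) : ℝ)|) (fun f => rfl),
      ← Finset.univ_product_univ, Finset.expect_product]
    -- Once the sequence `g` of pairs is fixed, the signs at the slots of `q` form a simple random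
    -- walk.
    refine Finset.expect_congr rfl fun g _ => ?_
    rw [← expect_sum_boolSign]
    simp [Finset.sum_filter]
  have hμ : (0 : ℝ) < T / Fintype.card Q := by
    have : 0 < Fintype.card Q := Fintype.card_pos
    positivity
  have h1 := expect_card_filter (T := T) q
  have h2 := expect_card_filter_sq_le (T := T) q
  set μ : ℝ := T / Fintype.card Q with hμdef
  rw [hsplit]
  -- The tangent to `1/√u` at `μ`, taken at `u = b + 1`, bounds `b / √(b + 1)` below by a quadratic
  -- in `b`, so two moments of `b` suffice.
  calc _ ≤ 𝔼 g : Fin T → Q, Real.sqrt (2 / Real.pi) * (1 / Real.sqrt μ *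
        (((Finset.univ.filter (fun t => g t = q)).card : ℝ) * (1 - (1 - μ) / (2 * μ))
          - ((Finset.univ.filter (fun t => g t = q)).card : ℝ) ^ 2 / (2 * μ))) := by
        simp_rw [← Finset.mul_expect]
        rw [Finset.expect_sub_distrib]
        simp_rw [← Finset.expect_mul, ← Finset.expect_div]
        rw [h1]
        gcongr
        have h3 : Real.sqrt μ = 1 / Real.sqrt μ * μ := by
          rw [one_div_mul_eq_div, Real.div_sqrt]
        calc Real.sqrt μ - 1 / Real.sqrt μ = 1 / Real.sqrt μ * (μ - 1) := by
              rw [mul_sub, ← h3, mul_one]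
          _ = 1 / Real.sqrt μ * (μ * (1 - (1 - μ) / (2 * μ)) - (μ + μ ^ 2) / (2 * μ)) := by
              field_simp
              ring
          _ ≤ _ := by gcongr
    _ ≤ _ := by
        refine Finset.expect_le_expect fun g _ => le_trans ?_ (le_walkMean_abs _)
        set b : ℝ := ((Finset.univ.filter (fun t => g t = q)).card : ℝ)
        have hb : 0 ≤ b := Nat.cast_nonneg _
        have := mul_le_mul_of_nonneg_left
          (one_div_sqrt_ge_tangent (by linarith : 0 < b + 1) hμ) hb
        gcongr
        calc _ = b * (1 / Real.sqrt μ * (1 - (b + 1 - μ) / (2 * μ))) := by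
              field_simp
              ring
          _ ≤ _ := this
          _ = _ := by ring

/-! ### Colouring the caches and double counting edges. -/

/-- Greedy colouring of a finite graph with more colours than the largest degree. -/
theorem exists_greedy_coloring {V : Type*} [Fintype V] [DecidableEq V] (r : V → V → Prop)
    [DecidableRel r] (hr : ∀ v w, r v w → r w v) {k : ℕ} (hk : 0 < k)
    (hdeg : ∀ v, (Finset.univ.filter (fun w => w ≠ v ∧ r v w)).card < k) :
    ∃ c : V → Fin k, ∀ v w, w ≠ v → r v w → c v ≠ c w := by
  suffices h : ∀ s : Finset V, ∃ c : V → Fin k, ∀ v ∈ s, ∀ w ∈ s, w ≠ v → r v w → c v ≠ c w by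
    obtain ⟨c, hc⟩ := h Finset.univ
    exact ⟨c, fun v w => hc v (Finset.mem_univ v) w (Finset.mem_univ w)⟩
  intro s
  induction s using Finset.induction_on with
  | empty => exact ⟨fun _ => ⟨0, hk⟩, by simp⟩
  | insert v s hv ih =>
    obtain ⟨c, hc⟩ := ih
    obtain ⟨a, ha⟩ : ∃ a, a ∉ (Finset.univ.filter (fun w => w ≠ v ∧ r v w)).image c := by
      by_contra! h
      have h1 := Finset.card_le_card (fun a _ => h a : (Finset.univ : Finset (Fin k)) ⊆ _)
      have h2 := (Finset.card_image_le (f := c)).trans_lt (hdeg v)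
      simp only [Finset.card_univ, Fintype.card_fin] at h1
      omega
    have ha' : ∀ w, w ≠ v → r v w → c w ≠ a := fun w hw hvw h =>
      ha (Finset.mem_image.2 ⟨w, by simp [hw, hvw], h⟩)
    refine ⟨Function.update c v a, fun u hu w hw hwu huw => ?_⟩
    by_cases huv : u = v
    · subst huv
      rw [Function.update_self, Function.update_of_ne hwu]
      exact (ha' w hwu huw).symm
    · by_cases hwv : w = v
      · subst hwv
        rw [Function.update_self, Function.update_of_ne huv]
        exact ha' u huv (hr _ _ huw)
      · rw [Function.update_of_ne huv, Function.update_of_ne hwv]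
        exact hc u ((Finset.mem_insert.1 hu).resolve_left huv) w
          ((Finset.mem_insert.1 hw).resolve_left hwv) hwu huw

theorem mem_cachesOf {n m : ℕ} {E : Finset (Fin n × Fin m)} {i : Fin n} {j : Fin m} :
    j ∈ cachesOf E i ↔ (i, j) ∈ E := by simp [cachesOf]

theorem mem_usersOf {n m : ℕ} {E : Finset (Fin n × Fin m)} {i : Fin n} {j : Fin m} :
    i ∈ usersOf E j ↔ (i, j) ∈ E := by simp [usersOf]

/-- The caches can be coloured with `min m (dL * d)` colours so that all the caches of a user have
different colours. -/
theorem exists_cache_coloring {n m d dL : ℕ} {E : Finset (Fin n × Fin m)} (hm : 0 < m)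
    (hd : 0 < d) (hdL : 0 < dL) (hc : ∀ i, (cachesOf E i).card = dL)
    (hu : ∀ j, (usersOf E j).card = d) :
    ∃ c : Fin m → Fin (min m (dL * d)),
      ∀ i, ∀ j ∈ cachesOf E i, ∀ k ∈ cachesOf E i, c j = c k → j = k := by
  have hpos : 0 < min m (dL * d) := lt_min hm (Nat.mul_pos hdL hd)
  obtain ⟨c, hcol⟩ := exists_greedy_coloring
    -- Caches sharing a user are adjacent: each has at most `m - 1` neighbours, and at most `d * (dL
    -- - 1)`.
    (fun j k : Fin m => ∃ i, (i, j) ∈ E ∧ (i, k) ∈ E)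
    (fun j k ⟨i, h1, h2⟩ => ⟨i, h2, h1⟩) hpos (fun j => by
      refine lt_min ?_ ?_
      · calc _ < (Finset.univ : Finset (Fin m)).card :=
              Finset.card_lt_card (Finset.filter_ssubset.2 ⟨j, Finset.mem_univ j, by simp⟩)
          _ = m := by simp
      · calc _ ≤ ((usersOf E j).biUnion fun i => (cachesOf E i).erase j).card := by
              refine Finset.card_le_card fun k hk => ?_
              obtain ⟨hkj, i, h1, h2⟩ := (Finset.mem_filter.1 hk).2
              exact Finset.mem_biUnion.2 ⟨i, mem_usersOf.2 h1,
                Finset.mem_erase.2 ⟨hkj, mem_cachesOf.2 h2⟩⟩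
          _ ≤ (usersOf E j).card * (dL - 1) := by
              refine Finset.card_biUnion_le_card_mul _ _ _ fun i hi => ?_
              rw [Finset.card_erase_of_mem (mem_cachesOf.2 (mem_usersOf.1 hi)), hc]
          _ < dL * d := by
              rw [hu, mul_comm]
              exact Nat.mul_lt_mul_of_pos_right (Nat.sub_lt hdL one_pos) hd)
  refine ⟨c, fun i j hj k hk hjk => ?_⟩
  by_contra hne
  exact hcol j k (fun h => hne h.symm) ⟨i, mem_cachesOf.1 hj, mem_cachesOf.1 hk⟩ hjk

theorem sum_cachesOf_comm {n m : ℕ} (E : Finset (Fin n × Fin m)) (φ : Fin m → ℝ) :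
    ∑ i, ∑ j ∈ cachesOf E i, φ j = ∑ j, ((usersOf E j).card : ℝ) * φ j := by
  rw [Finset.sum_comm' (t' := Finset.univ) (s' := usersOf E)
    (fun i j => by simp [mem_cachesOf, mem_usersOf])]
  simp

theorem users_mul_eq_caches_mul {n m d dL : ℕ} {E : Finset (Fin n × Fin m)}
    (hc : ∀ i, (cachesOf E i).card = dL) (hu : ∀ j, (usersOf E j).card = d) :
    (n : ℝ) * dL = m * d := by
  have := sum_cachesOf_comm E (fun _ => 1)
  simpa [hc, hu] using this

/-! ### Upper bound on the reward of any policy. -/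

theorem reward_nonneg {n m N C : ℕ} (E : Finset (Fin n × Fin m)) (x : Requests n N)
    (y : CacheConfig m N C) : 0 ≤ reward E x y :=
  Finset.sum_nonneg fun _ _ => le_min zero_le_one
    (Finset.sum_nonneg fun _ _ => by positivity)

theorem reward_le {n m N C : ℕ} (E : Finset (Fin n × Fin m)) (x : Requests n N)
    (y : CacheConfig m N C) : reward E x y ≤ n := by
  calc reward E x y ≤ ∑ _i : Fin n, (1 : ℝ) := Finset.sum_le_sum fun _ _ => min_le_left _ _
    _ = n := by simp

open scoped BigOperators in
/-- The mean reward when all users request the same random file. -/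
theorem expect_reward_le {n m N C dL : ℕ} {E : Finset (Fin n × Fin m)} {A : Type*} [Fintype A]
    [Nonempty A] (e : A ↪ Fin N) (hc : ∀ i, (cachesOf E i).card = dL) (y : CacheConfig m N C) :
    𝔼 a, reward E (fun _ => e a) y ≤ (n * dL * C : ℝ) / Fintype.card A := by
  rw [Fintype.expect_eq_sum_div_card]
  gcongr
  have h1 : ∀ j, ∑ a, (if e a ∈ y.1 j then (1 : ℝ) else 0) ≤ C := by
    intro j
    rw [Finset.sum_boole]
    have : (Finset.univ.filter (fun a => e a ∈ y.1 j)).card ≤ (y.1 j).card :=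
      Finset.card_le_card_of_injOn e (fun a ha => by simpa using ha) e.injective.injOn
    exact_mod_cast this.trans (y.2 j)
  calc ∑ a, reward E (fun _ => e a) y
      ≤ ∑ a, ∑ i : Fin n, ∑ j ∈ cachesOf E i, (if e a ∈ y.1 j then (1 : ℝ) else 0) :=
        Finset.sum_le_sum fun a _ => Finset.sum_le_sum fun i _ => min_le_right _ _
    _ = ∑ i : Fin n, ∑ j ∈ cachesOf E i, ∑ a, (if e a ∈ y.1 j then (1 : ℝ) else 0) := by
        rw [Finset.sum_comm]
        exact Finset.sum_congr rfl fun i _ => Finset.sum_comm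
    _ ≤ ∑ i : Fin n, ∑ j ∈ cachesOf E i, (C : ℝ) :=
        Finset.sum_le_sum fun i _ => Finset.sum_le_sum fun j _ => h1 j
    _ = n * dL * C := by simp [hc, mul_assoc]

theorem integrable_reward_config {Ω : Type*} [MeasurableSpace Ω] {n m N C : ℕ}
    (E : Finset (Fin n × Fin m)) (P : MeasureTheory.Measure Ω)
    [MeasureTheory.IsProbabilityMeasure P] (p : OnlinePolicy Ω n m N C) (x : Requests n N) (t : ℕ)
    (h : Fin t → Requests n N) :
    MeasureTheory.Integrable (fun ω => reward E x (p.config t h ω)) P := by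
  let _ : MeasurableSpace (CacheConfig m N C) := ⊤
  have hm : Measurable (p.config t h) := measurable_to_countable' fun y => p.measurable_config t h y
  refine MeasureTheory.Integrable.of_bound (C := n)
    ((measurable_from_top (f := reward E x)).comp hm).aestronglyMeasurable
    (Filter.Eventually.of_forall fun ω => ?_)
  rw [Real.norm_of_nonneg (reward_nonneg _ _ _)]
  exact reward_le _ _ _

open scoped BigOperators in
/-- No policy can exploit uniformly random requests. -/
theorem expect_policyReward_le {Ω : Type*} [MeasurableSpace Ω] {n m N C dL T : ℕ}
    {E : Finset (Fin n × Fin m)} (P : MeasureTheory.Measure Ω)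
    [MeasureTheory.IsProbabilityMeasure P] (p : OnlinePolicy Ω n m N C) {A : Type*} [Fintype A]
    [Nonempty A] (e : A ↪ Fin N) (hc : ∀ i, (cachesOf E i).card = dL) :
    𝔼 f : Fin T → A, policyReward E P p (fun t _ => e (f t))
      ≤ T * ((n * dL * C : ℝ) / Fintype.card A) := by
  have hint : ∀ f : Fin T → A, MeasureTheory.Integrable (fun ω => ∑ t : Fin T,
      reward E (fun _ => e (f t)) (p.config t (history (fun t _ => e (f t)) t) ω)) P :=
    fun f => MeasureTheory.integrable_finsetSum _ fun t _ => integrable_reward_config E P p _ _ _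
  have hpt : ∀ ω, 𝔼 f : Fin T → A, ∑ t : Fin T,
      reward E (fun _ => e (f t)) (p.config t (history (fun t _ => e (f t)) t) ω)
        ≤ T * ((n * dL * C : ℝ) / Fintype.card A) := by
    intro ω
    rw [Finset.expect_sum_comm]
    calc _ ≤ ∑ t : Fin T, (n * dL * C : ℝ) / Fintype.card A := by
          refine Finset.sum_le_sum fun t _ => ?_
          -- Resampling the request of slot `t` does not alter its history, so the configuration
          -- stays fixed while the request is uniform.
          rw [expect_eq_expect_update t]
          refine Finset.expect_le Finset.univ_nonempty fun f _ => ?_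
          have hh : ∀ a, history (fun s (_ : Fin n) => e (Function.update f t a s)) t
              = history (fun s _ => e (f s)) t := by
            intro a
            funext s i
            have hne : Fin.castLE t.2.le s ≠ t := fun h => by
              have := congrArg Fin.val h
              have := s.2
              simp at *
              omega
            simp only [history, Function.update_of_ne hne]
          simp_rw [hh, Function.update_self]
          exact expect_reward_le e hc _
      _ = _ := by simp
  simp only [policyReward]
  rw [Fintype.expect_eq_sum_div_card, ← MeasureTheory.integral_finsetSum _ fun f _ => hint f,
    ← MeasureTheory.integral_div]
  simp_rw [← Fintype.expect_eq_sum_div_card]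
  calc _ ≤ ∫ _ω, T * ((n * dL * C : ℝ) / Fintype.card A) ∂P := by
        refine MeasureTheory.integral_mono ?_ (MeasureTheory.integrable_const _) hpt
        simp_rw [Fintype.expect_eq_sum_div_card]
        exact (MeasureTheory.integrable_finsetSum _ fun f _ => hint f).div_const _
    _ = _ := by simp

/-! ### The static configuration chosen in hindsight. -/

/-- The excess of the requests for `(q, true)` over those for `(q, false)`. -/
def pairImbalance {T : ℕ} {Q : Type*} [DecidableEq Q] (f : Fin T → Q × Bool) (q : Q) : ℤ :=
  ∑ t, if (f t).1 = q then boolSign (f t).2 else 0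

/-- The more requested of the files `(q, true)` and `(q, false)`. -/
def popular {T : ℕ} {Q : Type*} [DecidableEq Q] (f : Fin T → Q × Bool) (q : Q) : Bool :=
  decide (0 ≤ pairImbalance f q)

/-- This is `max u v = (u + v + |u - v|) / 2` for the request counts `u`, `v` of the two files. -/
theorem sum_ite_eq_popular {T : ℕ} {Q : Type*} [DecidableEq Q] (f : Fin T → Q × Bool) (q : Q) :
    ∑ t, (if f t = (q, popular f q) then (1 : ℝ) else 0)
      = (((Finset.univ.filter (fun t => (f t).1 = q)).card : ℝ) + |(pairImbalance f q : ℝ)|) / 2 := by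
  have h1 : |(pairImbalance f q : ℝ)| = boolSign (popular f q) * pairImbalance f q := by
    by_cases h : 0 ≤ pairImbalance f q
    · have h' : (0 : ℝ) ≤ pairImbalance f q := by exact_mod_cast h
      simp [boolSign, popular, h, abs_of_nonneg h']
    · have h' : (pairImbalance f q : ℝ) ≤ 0 := by exact_mod_cast (not_le.1 h).le
      simp [boolSign, popular, h, abs_of_nonpos h']
  rw [h1]
  -- With the absolute value written as a signed imbalance, the identity holds slot by slot for
  -- either bit.
  generalize popular f q = β
  rw [pairImbalance, Finset.card_filter]
  push_cast
  rw [Finset.mul_sum, ← Finset.sum_add_distrib, Finset.sum_div]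
  refine Finset.sum_congr rfl fun t _ => ?_
  rcases hf : f t with ⟨q', b⟩
  by_cases hq : q' = q
  · cases b <;> cases β <;> simp [hq, boolSign]
  · simp [hq]

/-- With the caches of every user coloured differently, storing in every cache the popular file of
each of the `C` pairs of its colour serves no user twice. -/
theorem sum_le_bestStaticReward {n m N C T d k : ℕ} {E : Finset (Fin n × Fin m)}
    (hu : ∀ j, (usersOf E j).card = d) (c : Fin m → Fin k)
    (hcol : ∀ i, ∀ j ∈ cachesOf E i, ∀ l ∈ cachesOf E i, c j = c l → j = l)
    (e : (Fin k × Fin C) × Bool ↪ Fin N) (f : Fin T → (Fin k × Fin C) × Bool) :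
    ∑ j, (d : ℝ) * ∑ s : Fin C,
      (((Finset.univ.filter (fun t => (f t).1 = (c j, s))).card : ℝ)
        + |(pairImbalance f (c j, s) : ℝ)|) / 2
      ≤ bestStaticReward C E (fun t _ => e (f t)) := by
  let y : CacheConfig m N C := ⟨fun j => Finset.univ.image
    (fun s : Fin C => e ((c j, s), popular f (c j, s))),
    fun j => Finset.card_image_le.trans (by simp)⟩
  have hmem : ∀ a j, e a ∈ y.1 j ↔ ∃ s : Fin C, a = ((c j, s), popular f (c j, s)) := by
    intro a j
    simp [y, eq_comm]
  refine le_trans (le_of_eq ?_) (le_ciSup (Set.finite_range _).bddAbove y)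
  have hrew : ∀ a, reward E (fun _ => e a) y
      = ∑ j, (d : ℝ) * ∑ s : Fin C, if a = ((c j, s), popular f (c j, s)) then (1 : ℝ) else 0 := by
    intro a
    have h1 : ∀ i, min 1 (∑ j ∈ cachesOf E i, if e a ∈ y.1 j then (1 : ℝ) else 0)
        = ∑ j ∈ cachesOf E i, if e a ∈ y.1 j then (1 : ℝ) else 0 := by
      intro i
      refine min_eq_right ?_
      rw [Finset.sum_boole]
      have : ((cachesOf E i).filter (fun j => e a ∈ y.1 j)).card ≤ 1 := by
        refine Finset.card_le_one.2 fun j hj l hl => ?_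
        rw [Finset.mem_filter, hmem] at hj hl
        obtain ⟨hj, s, hs⟩ := hj
        obtain ⟨hl, s', hs'⟩ := hl
        refine hcol i j hj l hl ?_
        have := congrArg (fun z => z.1.1) (hs.symm.trans hs')
        exact this
      exact_mod_cast this
    have h2 : ∀ j, (if e a ∈ y.1 j then (1 : ℝ) else 0)
        = ∑ s : Fin C, if a = ((c j, s), popular f (c j, s)) then (1 : ℝ) else 0 := by
      intro j
      by_cases h : e a ∈ y.1 j
      · rw [if_pos h]
        obtain ⟨s, hs⟩ := (hmem a j).1 h
        rw [Finset.sum_eq_single s, if_pos hs]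
        · intro s' _ hne
          refine if_neg fun h' => hne ?_
          exact congrArg (fun z => z.1.2) (h'.symm.trans hs)
        · simp
      · rw [if_neg h]
        exact (Finset.sum_eq_zero fun s _ => if_neg fun hs => h ((hmem a j).2 ⟨s, hs⟩)).symm
    rw [reward, Finset.sum_congr rfl fun i _ => h1 i, sum_cachesOf_comm]
    exact Finset.sum_congr rfl fun j _ => by rw [hu, h2]
  simp_rw [hrew]
  rw [Finset.sum_comm]
  refine Finset.sum_congr rfl fun j _ => ?_
  rw [← Finset.mul_sum, Finset.sum_comm]
  simp_rw [sum_ite_eq_popular]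

/-! ### Mean regret and conclusion. -/

open scoped BigOperators in
/-- The mean regret on uniformly random requests. -/
theorem le_expect_regretOn {Ω : Type*} [MeasurableSpace Ω] {n m N C T d dL k : ℕ}
    {E : Finset (Fin n × Fin m)} (hC : 0 < C) (hk : 0 < k) (hT : 0 < T)
    (hc : ∀ i, (cachesOf E i).card = dL) (hu : ∀ j, (usersOf E j).card = d) (c : Fin m → Fin k)
    (hcol : ∀ i, ∀ j ∈ cachesOf E i, ∀ l ∈ cachesOf E i, c j = c l → j = l)
    (e : (Fin k × Fin C) × Bool ↪ Fin N) (P : MeasureTheory.Measure Ω)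
    [MeasureTheory.IsProbabilityMeasure P] (p : OnlinePolicy Ω n m N C) :
    (m * d * C : ℝ) / 2 * (Real.sqrt (2 / Real.pi) * (Real.sqrt (T / (k * C : ℝ))
        - 1 / Real.sqrt (T / (k * C : ℝ))))
      ≤ 𝔼 f : Fin T → (Fin k × Fin C) × Bool, regretOn E P p (fun t _ => e (f t)) := by
  have : NeZero k := ⟨hk.ne'⟩
  have : NeZero C := ⟨hC.ne'⟩
  have hcard : (Fintype.card (Fin k × Fin C) : ℝ) = k * C := by simp
  have hcard' : (Fintype.card ((Fin k × Fin C) × Bool) : ℝ) = k * C * 2 := by simp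
  have hpol := expect_policyReward_le (T := T) P p e hc
  have hcount : ∀ q : Fin k × Fin C, 𝔼 f : Fin T → (Fin k × Fin C) × Bool,
      ((Finset.univ.filter (fun t => (f t).1 = q)).card : ℝ) = T / (k * C : ℝ) := by
    intro q
    simp_rw [Finset.card_filter]
    push_cast
    rw [Finset.expect_sum_comm]
    simp_rw [expect_apply_coord _ (fun a : (Fin k × Fin C) × Bool => if a.1 = q then (1 : ℝ) else 0)]
    rw [← Finset.univ_product_univ, Finset.expect_product]
    rw [Finset.expect_congr rfl fun i _ => Finset.expect_const (Finset.univ_nonempty (α := Bool))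
      (if i = q then (1 : ℝ) else 0)]
    rw [Fintype.expect_eq_sum_div_card, hcard]
    simp [div_eq_mul_inv]
  set L : ℝ := Real.sqrt (2 / Real.pi) * (Real.sqrt (T / (k * C : ℝ))
        - 1 / Real.sqrt (T / (k * C : ℝ))) with hL
  have himb : ∀ q : Fin k × Fin C,
      L ≤ 𝔼 f : Fin T → (Fin k × Fin C) × Bool, |(pairImbalance f q : ℝ)| := by
    intro q
    have := le_expect_abs_sum_ite_boolSign hT q
    rw [hcard] at this
    exact this
  have hstat : (m * d * C : ℝ) * ((T / (k * C : ℝ) + L) / 2)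
      ≤ 𝔼 f : Fin T → (Fin k × Fin C) × Bool, bestStaticReward C E (fun t _ => e (f t)) := by
    refine le_trans ?_ (Finset.expect_le_expect fun f _ => sum_le_bestStaticReward hu c hcol e f)
    rw [Finset.expect_sum_comm]
    simp_rw [← Finset.mul_expect, Finset.expect_sum_comm, ← Finset.expect_div,
      Finset.expect_add_distrib, hcount]
    calc (m * d * C : ℝ) * ((T / (k * C : ℝ) + L) / 2)
        = ∑ _j : Fin m, (d : ℝ) * ∑ _s : Fin C, (T / (k * C : ℝ) + L) / 2 := by
          simp; ring
      _ ≤ _ := by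
          gcongr
          exact himb _
  have hnd := users_mul_eq_caches_mul hc hu
  simp only [regretOn]
  rw [Finset.expect_sub_distrib]
  -- Since `n * dL = m * d`, the policy bound equals the count part of the static reward; only the
  -- imbalance term `L` survives.
  have hpol' : (T : ℝ) * ((n * dL * C : ℝ) / Fintype.card ((Fin k × Fin C) × Bool))
      = (m * d * C : ℝ) * (T / (k * C : ℝ) / 2) := by
    rw [hcard', hnd]
    field_simp
  rw [hpol'] at hpol
  linarith

theorem mainTheorem2 (n m d C : ℕ) (hn : 0 < n) (hm : 0 < m) (hd : 0 < d) (hC : 0 < C) :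
    ∃ K : ℝ, 0 < K ∧
      ∀ (dL N : ℕ) (E : Finset (Fin n × Fin m)),
        (∀ i, (cachesOf E i).card = dL) →
        (∀ j, (usersOf E j).card = d) →
        2 * C * min m (dL * d) ≤ N →
        ∀ T : ℕ, 0 < T →
        ∀ (Ω : Type*) [MeasurableSpace Ω] (P : MeasureTheory.Measure Ω)
          [MeasureTheory.IsProbabilityMeasure P] (p : OnlinePolicy Ω n m N C),
          ∃ x : Fin T → Requests n N,
            max (Real.sqrt ((m : ℝ) * n * C * T / (2 * Real.pi)))
                ((d : ℝ) * Real.sqrt ((m : ℝ) * C * T / (2 * Real.pi)))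
              - K / Real.sqrt T ≤ regretOn E P p x := by
  -- The error term contains `1/√(T/(kC)) = √(kC)/√T`; replacing `k` by `m` makes the constant
  -- independent of `dL` and `N`.
  refine ⟨(m * d * C : ℝ) / 2 * (Real.sqrt (2 / Real.pi) * Real.sqrt (m * C)), by positivity, ?_⟩
  intro dL N E hc hu hN T hT Ω _ P _ p
  have hnd := users_mul_eq_caches_mul hc hu
  have hdL : 0 < dL := by
    refine Nat.pos_of_ne_zero fun h => ?_
    have : (0 : ℝ) < m * d := by positivity
    rw [← hnd, h] at this
    simp at this
  obtain ⟨c, hcol⟩ := exists_cache_coloring hm hd hdL hc hu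
  have hk : 0 < min m (dL * d) := lt_min hm (Nat.mul_pos hdL hd)
  have hkm : ((min m (dL * d) : ℕ) : ℝ) ≤ m := by exact_mod_cast min_le_left _ _
  have hkd : ((min m (dL * d) : ℕ) : ℝ) ≤ dL * d := by exact_mod_cast min_le_right _ _
  generalize min m (dL * d) = k at *
  obtain ⟨e⟩ : Nonempty ((Fin k × Fin C) × Bool ↪ Fin N) := by
    refine Function.Embedding.nonempty_of_card_le ?_
    simp only [Fintype.card_prod, Fintype.card_fin, Fintype.card_bool]
    linarith
  have hmean := le_expect_regretOn hC hk hT hc hu c hcol e P p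
  have : NeZero k := ⟨hk.ne'⟩
  have : NeZero C := ⟨hC.ne'⟩
  obtain ⟨f, -, hf⟩ := Finset.exists_le_of_le_expect Finset.univ_nonempty hmean
  refine ⟨_, le_trans ?_ hf⟩
  have hkR : (0 : ℝ) < k := by exact_mod_cast hk
  have hCR : (0 : ℝ) < C := by exact_mod_cast hC
  have hTR : (0 : ℝ) < T := by exact_mod_cast hT
  have hπ := Real.pi_pos
  have hlead : (m * d * C : ℝ) / 2 * (Real.sqrt (2 / Real.pi) * Real.sqrt (T / (k * C : ℝ)))
      = Real.sqrt ((m * d) ^ 2 * C * T / (2 * Real.pi * k)) := by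
    rw [← Real.sqrt_mul (by positivity), ← Real.sqrt_sq (by positivity : (0 : ℝ) ≤ m * d * C / 2),
      ← Real.sqrt_mul (by positivity)]
    congr 1
    field_simp
  -- `k ≤ dL * d` and `n * dL = m * d` give this term; `k ≤ m` gives the one in `h2`.
  have h1 : Real.sqrt ((m : ℝ) * n * C * T / (2 * Real.pi))
      ≤ Real.sqrt ((m * d) ^ 2 * C * T / (2 * Real.pi * k)) := by
    refine Real.sqrt_le_sqrt ?_
    have h : (n : ℝ) * k ≤ m * d * d := by
      calc (n : ℝ) * k ≤ n * (dL * d) := by gcongr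
        _ = m * d * d := by rw [← mul_assoc, hnd]
    calc (m : ℝ) * n * C * T / (2 * Real.pi) = m * C * T * (n * k) / (2 * Real.pi * k) := by
          field_simp
      _ ≤ m * C * T * (m * d * d) / (2 * Real.pi * k) := by gcongr
      _ = _ := by ring
  have h2 : (d : ℝ) * Real.sqrt ((m : ℝ) * C * T / (2 * Real.pi))
      ≤ Real.sqrt ((m * d) ^ 2 * C * T / (2 * Real.pi * k)) := by
    rw [← Real.sqrt_sq (by positivity : (0 : ℝ) ≤ d), ← Real.sqrt_mul (by positivity),
      Real.sqrt_sq (by positivity)]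
    refine Real.sqrt_le_sqrt ?_
    calc (d : ℝ) ^ 2 * ((m : ℝ) * C * T / (2 * Real.pi))
        = m * d ^ 2 * C * T * k / (2 * Real.pi * k) := by field_simp
      _ ≤ m * d ^ 2 * C * T * m / (2 * Real.pi * k) := by gcongr
      _ = _ := by ring
  have herr : (m * d * C : ℝ) / 2 * (Real.sqrt (2 / Real.pi) * (1 / Real.sqrt (T / (k * C : ℝ))))
      ≤ (m * d * C : ℝ) / 2 * (Real.sqrt (2 / Real.pi) * Real.sqrt (m * C)) / Real.sqrt T := by
    rw [mul_div_assoc ((m * d * C : ℝ) / 2), mul_div_assoc (Real.sqrt (2 / Real.pi)),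
      Real.sqrt_div hTR.le, one_div_div]
    gcongr
  rw [mul_sub, mul_sub, hlead]
  exact sub_le_sub (max_le h1 h2) herr
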